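/- Let $N_P,N_Q$ be lattices (free abelian groups of finite rank) with dual lattices $M_P,M_Q$, and let $P\subset (N_P)_{\mathbb R}$ and $Q\subset (N_Q)_{\mathbb R}$ be full-dimensional lattice polytopes with respect to $N_P$ and $N_Q$, each containing the origin (possibly on its boundary). Let $$P\oplus Q=\operatorname{conv}\big((P\times\{0\})\cup(\{0\}\times Q)\big)\subset (N_P\oplus N_Q)_{\mathbb R}$$ be their free sum, a lattice polytope with respect to $N_P\oplus N_Q$. For a lattice polytope $R$ with respect to a lattice $N$, let $h^*(R;t)$ be its $h^*$-polynomial, defined by $$\sum_{m\ge 0}\#(mR\cap N)\,t^m=\frac{h^*(R;t)}{(1-t)^{\dim R+1}}$$ as an identity of formal power series in $\mathbb Z[[t]]$. Let $P^\vee=\{u\in (M_P)_{\mathbb R}\mid \langle u,v\rangle\ge -1\text{ for all }v\in P\}$, and let $r_P$ be the least positive integer $r$ such that $rP^\vee$ is a lattice polyhedron with respect to $M_P$ (a rational polyhedron each of whose nonempty faces contains a point of $M_P$; here equivalently, all of its vertices lie in $M_P$). Define $Q^\vee$ and $r_Q$ in the same way. Then $$h^*(P\oplus Q;t)=h^*(P;t)\,h^*(Q;t)\iff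 r_P=1\ \text{ or }\ r_Q=1.$$ -/

import Mathlib

namespace LatticePolytope

open scoped Pointwise

/-- `P` is a lattice polytope with respect to the lattice `L`: the convex hull of finitely many
points of `L`. -/
def IsLatticePolytope {E : Type*} [AddCommGroup E] [Module ℝ E] (L : Submodule ℤ E)
    (P : Set E) : Prop :=
  ∃ s : Finset E, (s : Set E) ⊆ (L : Set E) ∧ P = convexHull ℝ (s : Set E)

/-- The dimension of a polytope: the dimension of its affine span. -/
noncomputable def dim {E : Type*} [AddCommGroup E] [Module ℝ E] (P : Set E) : ℕ :=
  Module.finrank ℝ (vectorSpan ℝ P)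

/-- The number of points of the lattice `L` in the dilate `m P`. -/
noncomputable def ehrhart {E : Type*} [AddCommGroup E] [Module ℝ E] (L : Submodule ℤ E)
    (P : Set E) (m : ℕ) : ℕ :=
  (((m : ℝ) • P) ∩ (L : Set E)).ncard

/-- The `h^*`-polynomial of `P`, as an element of `ℤ⟦t⟧` (which contains `ℤ[t]`): the series
`h` determined by `∑_{m ≥ 0} #(mP ∩ L) t^m = h / (1 - t)^(dim P + 1)`. -/
noncomputable def hStar {E : Type*} [AddCommGroup E] [Module ℝ E] (L : Submodule ℤ E)
    (P : Set E) : PowerSeries ℤ :=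
  (1 - PowerSeries.X) ^ (dim P + 1) * PowerSeries.mk (fun m => (ehrhart L P m : ℤ))

/-- The free sum (direct sum) `P ⊕ Q = conv((P × 0) ∪ (0 × Q))`. -/
def freeSum {E F : Type*} [AddCommGroup E] [Module ℝ E] [AddCommGroup F] [Module ℝ F]
    (P : Set E) (Q : Set F) : Set (E × F) :=
  convexHull ℝ ((P ×ˢ ({0} : Set F)) ∪ (({0} : Set E) ×ˢ Q))

/-- The dual lattice `Hom(L, ℤ)`, realized inside the dual vector space as the linear forms
taking integer values on `L`. -/
def dualLattice {E : Type*} [AddCommGroup E] [Module ℝ E] (L : Submodule ℤ E) :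
    Submodule ℤ (Module.Dual ℝ E) where
  carrier := {u | ∀ v ∈ L, ∃ n : ℤ, u v = n}
  zero_mem' := fun v _ => ⟨0, by simp⟩
  add_mem' := by
    intro a b ha hb v hv
    obtain ⟨m, hm⟩ := ha v hv
    obtain ⟨n, hn⟩ := hb v hv
    exact ⟨m + n, by simp [hm, hn]⟩
  smul_mem' := by
    intro c a ha v hv
    obtain ⟨m, hm⟩ := ha v hv
    exact ⟨c * m, by simp [hm]⟩

/-- The dual polyhedron `P^∨ = {u | ⟨u, v⟩ ≥ -1 for all v ∈ P}`. -/
def dualPolyhedron {E : Type*} [AddCommGroup E] [Module ℝ E] (P : Set E) :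
    Set (Module.Dual ℝ E) :=
  {u | ∀ v ∈ P, -1 ≤ u v}

/-- `S` is a polyhedron, rational with respect to the lattice `M`: a finite intersection of
half-spaces whose normals lie in the dual lattice. (Offsets are not restricted here; in
`IsLatticePolyhedron` they are controlled by the lattice points on the faces.) -/
def IsRationalPolyhedron {W : Type*} [AddCommGroup W] [Module ℝ W] (M : Submodule ℤ W)
    (S : Set W) : Prop :=
  ∃ T : Finset (Module.Dual ℝ W × ℝ),
    (∀ p ∈ T, p.1 ∈ dualLattice M) ∧ S = {x | ∀ p ∈ T, p.2 ≤ p.1 x}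

/-- The set of points of `S` at which the linear form `l` is maximal on `S`. For a polyhedron `S`,
its nonempty faces are exactly the nonempty sets of this form (`l = 0` gives `S` itself). -/
def face {W : Type*} [AddCommGroup W] [Module ℝ W] (S : Set W) (l : Module.Dual ℝ W) : Set W :=
  {x | x ∈ S ∧ ∀ y ∈ S, l y ≤ l x}

/-- `S` is a lattice polyhedron with respect to `M`: a rational polyhedron each of whose nonempty
faces contains a point of `M`. When `S` has a vertex, this says that all vertices of `S` lie
in `M`, since then every nonempty face contains a vertex. -/
def IsLatticePolyhedron {W : Type*} [AddCommGroup W] [Module ℝ W] (M : Submodule ℤ W)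
    (S : Set W) : Prop :=
  IsRationalPolyhedron M S ∧
    ∀ l : Module.Dual ℝ W, (face S l).Nonempty → (face S l ∩ (M : Set W)).Nonempty

/-- `r_P`: the least positive integer `r` such that `r P^∨` is a lattice polyhedron with respect
to the dual lattice. -/
noncomputable def dualDenominator {E : Type*} [AddCommGroup E] [Module ℝ E] (L : Submodule ℤ E)
    (P : Set E) : ℕ :=
  sInf {r : ℕ | 0 < r ∧ IsLatticePolyhedron (dualLattice L) ((r : ℝ) • dualPolyhedron P)}

end LatticePolytope

namespace LatticePolytope

open scoped Pointwise

/-! ### Vertices of the dual polyhedron. -/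

section Dual

variable {E : Type*} [AddCommGroup E] [Module ℝ E]

/-! Let `g_P v` be the least `a ≥ 0` with `v ∈ a • P`, infinite off the cone over `P`. A pair `(v,
w)` lies in `m • freeSum P Q` iff `g_P v + g_Q w ≤ m`. After division by the power of `1 - t`, the
product of the two `h^*`-series counts lattice pairs with `⌈g_P v⌉ + ⌈g_Q w⌉ ≤ m`. So the identity
says exactly that the two gauges can be rounded up separately (`hStar_freeSum_eq_iff`).

This holds if one gauge is integral on lattice points of its cone. Otherwise suitable multiples give
`v`, `w` whose gauges have fractional parts in `(0, 1/2]`, and rounding separately costs one unit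
too much (`roundsSeparately_iff`).

By duality `g_P v` is the maximum of `-u v` over vertices `u` of the dual polyhedron, so it is
integral iff these vertices are dual lattice points, i.e. `r_P = 1`
(`isLatticePolyhedron_dualPolyhedron_iff`). -/

theorem dualPolyhedron_convexHull (s : Set E) :
    dualPolyhedron (convexHull ℝ s) = dualPolyhedron s := by
  ext u
  refine ⟨fun h v hv => h v (subset_convexHull ℝ s hv), fun h v hv => ?_⟩
  exact convexHull_min (t := {x | -1 ≤ u x}) h (convex_halfSpace_ge u.isLinear _) hv

theorem zero_mem_dualPolyhedron (P : Set E) : (0 : Module.Dual ℝ E) ∈ dualPolyhedron P :=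
  fun v _ => by simp

theorem neg_le_of_mem_smul {P : Set E} {a : ℝ} (ha : 0 ≤ a) {v : E} (hv : v ∈ a • P)
    {u : Module.Dual ℝ E} (hu : u ∈ dualPolyhedron P) : -a ≤ u v := by
  obtain ⟨p, hp, rfl⟩ := hv
  have := hu p hp
  simp only [map_smul, smul_eq_mul]
  nlinarith

theorem span_eq_top_of_affineSpan {s : Set E} (h : affineSpan ℝ s = ⊤) : Submodule.span ℝ s = ⊤ := by
  rw [eq_top_iff]
  intro x _
  have hx : x ∈ affineSpan ℝ s := by rw [h]; trivial
  exact affineSpan_le_toAffineSubspace_span hx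

theorem smul_mono {P : Set E} (hc : Convex ℝ P) (h0 : (0 : E) ∈ P) {a b : ℝ} (ha : 0 ≤ a)
    (hab : a ≤ b) : a • P ⊆ b • P := by
  rintro _ ⟨p, hp, rfl⟩
  rcases hab.eq_or_lt with rfl | h
  · exact ⟨p, hp, rfl⟩
  have hb : 0 < b := ha.trans_lt h
  refine ⟨(a / b) • p, hc.smul_mem_of_zero_mem h0 hp ⟨by positivity, (div_le_one hb).2 hab⟩, ?_⟩
  simp only [smul_smul]
  congr 1
  field_simp

/-- A vertex of the polyhedron dual to the convex hull of `s`. -/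
def IsDualVertex (s : Set E) (u : Module.Dual ℝ E) : Prop :=
  u ∈ dualPolyhedron s ∧ Submodule.span ℝ {p | p ∈ s ∧ u p = -1} = ⊤

/-- A vertex is determined by its tight points, since they span, and `s` has finitely many subsets.
-/
theorem finite_isDualVertex (s : Finset E) : {u | IsDualVertex (s : Set E) u}.Finite := by
  classical
  refine Set.Finite.of_finite_image (f := fun u => {p | p ∈ (s : Set E) ∧ u p = -1})
    (s.finite_toSet.finite_subsets.subset ?_) ?_
  · rintro _ ⟨u, _, rfl⟩ p hp
    exact hp.1
  · intro u hu u' _ h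
    refine LinearMap.ext_on hu.2 fun p hp => ?_
    have hp' : p ∈ {p | p ∈ (s : Set E) ∧ u' p = -1} := by
      have h' : {p | p ∈ (s : Set E) ∧ u p = -1} = {p | p ∈ (s : Set E) ∧ u' p = -1} := h
      exact h' ▸ hp
    rw [hp.2, hp'.2]

/-- A simplex pivot: move `u` along a direction vanishing on its tight points and not increasing the
value at `v`, until a new constraint becomes tight. The lower bound `c` guarantees that some
constraint blocks the way when the value strictly decreases. -/
theorem exists_tight_lt [DecidableEq E] (s : Finset E) (hs : Submodule.span ℝ (s : Set E) = ⊤)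
    {v : E} {c : ℝ} (hc : ∀ u ∈ dualPolyhedron (s : Set E), c ≤ u v) {u : Module.Dual ℝ E}
    (hu : u ∈ dualPolyhedron (s : Set E)) (hn : ¬ IsDualVertex (s : Set E) u) :
    ∃ u' ∈ dualPolyhedron (s : Set E), u' v ≤ u v ∧
      (s.filter (fun p => u p = -1)).card < (s.filter (fun p => u' p = -1)).card := by
  have hlt : Submodule.span ℝ {p | p ∈ (s : Set E) ∧ u p = -1} < ⊤ :=
    lt_top_iff_ne_top.2 fun h => hn ⟨hu, h⟩
  obtain ⟨d₀, hd₀, hker⟩ := Submodule.exists_le_ker_of_lt_top _ hlt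
  have htight₀ : ∀ p ∈ s, u p = -1 → d₀ p = 0 := fun p hp h =>
    hker (Submodule.subset_span ⟨hp, h⟩)
  obtain ⟨p₀, hp₀, hdp₀⟩ : ∃ p ∈ s, d₀ p ≠ 0 := by
    by_contra! h
    exact hd₀ (LinearMap.ext_on hs fun p hp => by simpa using h p hp)
  obtain ⟨d, htight, hdv, q, hq, hdq⟩ : ∃ d : Module.Dual ℝ E,
      (∀ p ∈ s, u p = -1 → d p = 0) ∧ d v ≤ 0 ∧ ∃ q ∈ s, d q < 0 := by
    have hneg : ∀ p ∈ s, u p = -1 → (-d₀) p = 0 := fun p hp h => by simp [htight₀ p hp h]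
    by_cases hv : d₀ v = 0
    · rcases lt_or_gt_of_ne hdp₀ with h | h
      · exact ⟨d₀, htight₀, hv.le, p₀, hp₀, h⟩
      · exact ⟨-d₀, hneg, by simp [hv], p₀, hp₀, by simpa using h⟩
    · obtain ⟨d, hd, hdv⟩ : ∃ d : Module.Dual ℝ E,
          (∀ p ∈ s, u p = -1 → d p = 0) ∧ d v < 0 := by
        rcases lt_or_gt_of_ne hv with h | h
        · exact ⟨d₀, htight₀, h⟩
        · exact ⟨-d₀, hneg, by simpa using h⟩
      refine ⟨d, hd, hdv.le, ?_⟩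
      by_contra! h
      have key : ∀ t : ℝ, 0 ≤ t → c ≤ u v + t * d v := fun t ht => by
        refine hc (u + t • d) fun p hp => ?_
        have := mul_nonneg ht (h p hp)
        have := hu p hp
        simp only [LinearMap.add_apply, LinearMap.smul_apply, smul_eq_mul]
        linarith
      have h0 := key 0 le_rfl
      -- At this time the value at `v` would be `c - 1`.
      have h1 := key ((u v - c + 1) / (-d v)) (div_nonneg (by linarith) (by linarith))
      have : (u v - c + 1) / (-d v) * d v = -(u v - c + 1) := by
        rw [div_neg, neg_mul, div_mul_cancel₀ _ hdv.ne]
      linarith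
  -- Ratio test: `r` is the first constraint to become tight.
  obtain ⟨r, hr, hmin⟩ := (s.filter (fun p => d p < 0)).exists_min_image
    (fun p => (u p + 1) / (-d p)) ⟨q, Finset.mem_filter.2 ⟨hq, hdq⟩⟩
  rw [Finset.mem_filter] at hr
  set t := (u r + 1) / (-d r) with ht
  have ht0 : 0 ≤ t := div_nonneg (by linarith [hu r hr.1]) (by linarith [hr.2])
  have happly : ∀ p, (u + t • d) p = u p + t * d p := fun p => by simp
  refine ⟨u + t • d, fun p hp => ?_, ?_, ?_⟩
  · rw [happly]
    have hup := hu p hp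
    rcases le_or_gt 0 (d p) with h | h
    · nlinarith [mul_nonneg ht0 h]
    · have := hmin p (Finset.mem_filter.2 ⟨hp, h⟩)
      rw [le_div_iff₀ (by linarith)] at this
      linarith
  · rw [happly]
    nlinarith
  · refine Finset.card_lt_card (Finset.ssubset_iff_of_subset ?_ |>.2 ⟨r, ?_, ?_⟩)
    · intro p hp
      rw [Finset.mem_filter] at hp ⊢
      refine ⟨hp.1, ?_⟩
      rw [happly, htight p hp.1 hp.2, hp.2]
      simp
    · rw [Finset.mem_filter]
      refine ⟨hr.1, ?_⟩
      have hne := hr.2.ne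
      rw [happly, ht]
      field_simp
      ring
    · rw [Finset.mem_filter]
      rintro ⟨h1, h2⟩
      exact hr.2.ne (htight r h1 h2)

theorem exists_isDualVertex_le (s : Finset E) (hs : Submodule.span ℝ (s : Set E) = ⊤)
    {v : E} {c : ℝ} (hc : ∀ u ∈ dualPolyhedron (s : Set E), c ≤ u v) {u : Module.Dual ℝ E}
    (hu : u ∈ dualPolyhedron (s : Set E)) :
    ∃ u', IsDualVertex (s : Set E) u' ∧ u' v ≤ u v := by
  classical
  induction h : s.card - (s.filter (fun p => u p = -1)).card using Nat.strong_induction_on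
    generalizing u with
  | _ n ih =>
    by_cases hv : IsDualVertex (s : Set E) u
    · exact ⟨u, hv, le_rfl⟩
    obtain ⟨u₁, hu₁, hle, hlt⟩ := exists_tight_lt s hs hc hu hv
    have h1 := Finset.card_filter_le s (fun p => u₁ p = -1)
    obtain ⟨u', hu', hle'⟩ := ih _ (by omega) hu₁ rfl
    exact ⟨u', hu', hle'.trans hle⟩

theorem exists_isDualVertex_forall_le (s : Finset E) (hs : Submodule.span ℝ (s : Set E) = ⊤)
    {v : E} {c : ℝ} (hc : ∀ u ∈ dualPolyhedron (s : Set E), c ≤ u v) :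
    ∃ u, IsDualVertex (s : Set E) u ∧ ∀ u' ∈ dualPolyhedron (s : Set E), u v ≤ u' v := by
  obtain ⟨u₀, hu₀, -⟩ := exists_isDualVertex_le s hs hc (zero_mem_dualPolyhedron _)
  obtain ⟨u, hu, hmin⟩ := Set.exists_min_image _ (fun u => u v) (finite_isDualVertex s) ⟨u₀, hu₀⟩
  refine ⟨u, hu, fun u' hu' => ?_⟩
  obtain ⟨u₁, hu₁, hle⟩ := exists_isDualVertex_le s hs hc hu'
  exact (hmin u₁ hu₁).trans hle

end Dual

/-! ### Polarity and the gauge. -/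

section Normed

variable {E : Type*} [NormedAddCommGroup E] [NormedSpace ℝ E]

theorem IsLatticePolytope.isCompact {L : Submodule ℤ E} {P : Set E}
    (hP : IsLatticePolytope L P) : IsCompact P := by
  obtain ⟨s, -, rfl⟩ := hP
  exact (s.finite_toSet.isCompact_convexHull (𝕜 := ℝ))

theorem IsLatticePolytope.convex {L : Submodule ℤ E} {P : Set E}
    (hP : IsLatticePolytope L P) : Convex ℝ P := by
  obtain ⟨s, -, rfl⟩ := hP
  exact convex_convexHull ℝ _

/-- For a positive dilation factor this is Hahn–Banach separation. The case `a = 0` follows by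
shrinking the factor, as `P` is bounded. -/
theorem mem_smul_of_dual {P : Set E} (hc : Convex ℝ P) (hk : IsCompact P) (h0 : (0 : E) ∈ P)
    {a : ℝ} (ha : 0 ≤ a) {v : E} (h : ∀ u ∈ dualPolyhedron P, -a ≤ u v) : v ∈ a • P := by
  have key : ∀ b : ℝ, 0 < b → a ≤ b → v ∈ b • P := by
    intro b hb hab
    by_contra hv
    have hv' : b⁻¹ • v ∉ P := fun hp => hv ((Set.mem_smul_set_iff_inv_smul_mem₀ hb.ne' _ _).2 hp)
    obtain ⟨f, c, hfc, hP⟩ := geometric_hahn_banach_point_closed hc hk.isClosed hv'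
    have hc0 : c < 0 := by simpa using hP 0 h0
    have hfv : f v < b * c := by
      rw [map_smul, smul_eq_mul] at hfc
      rwa [inv_mul_lt_iff₀ hb] at hfc
    -- Rescaling the separating form moves its level `c < 0` to `-1`, so it lies in the dual.
    have := h ((-c)⁻¹ • (f : E →ₗ[ℝ] ℝ)) fun p hp => by
      have := hP p hp
      simp only [LinearMap.smul_apply, ContinuousLinearMap.coe_coe, smul_eq_mul]
      rw [inv_mul_eq_div, le_div_iff₀ (by linarith)]
      linarith
    simp only [LinearMap.smul_apply, ContinuousLinearMap.coe_coe, smul_eq_mul] at this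
    rw [inv_mul_eq_div, le_div_iff₀ (by linarith)] at this
    nlinarith
  rcases ha.eq_or_lt with rfl | ha
  · obtain ⟨R, hR, hPR⟩ := hk.isBounded.exists_pos_norm_le
    have hv0 : v = 0 := by
      by_contra hv
      have hv := norm_pos_iff.2 hv
      -- This factor would force `‖v‖ ≤ ‖v‖ / 2`.
      obtain ⟨p, hp, hpv⟩ := key (‖v‖ / (2 * R)) (by positivity) (by positivity)
      have h1 : ‖v‖ = ‖v‖ / (2 * R) * ‖p‖ := by
        conv_lhs => rw [← hpv]
        simp only [norm_smul, Real.norm_eq_abs]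
        rw [abs_of_nonneg (by positivity)]
      have h2 : ‖v‖ / (2 * R) * ‖p‖ ≤ ‖v‖ / (2 * R) * R :=
        mul_le_mul_of_nonneg_left (hPR p hp) (by positivity)
      have h3 : ‖v‖ / (2 * R) * R = ‖v‖ / 2 := by field_simp
      linarith
    exact ⟨0, h0, by simp [hv0]⟩
  · exact key a ha le_rfl

theorem finite_smul_inter [FiniteDimensional ℝ E] (L : Submodule ℤ E) [DiscreteTopology L] {P : Set E}
    (hk : IsCompact P) (a : ℝ) : ((a • P) ∩ (L : Set E)).Finite :=
  Metric.finite_isBounded_inter_isClosed DiscreteTopology.isDiscrete (hk.smul a).isBounded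
    (AddSubgroup.isClosed_of_discrete (H := L.toAddSubgroup))

/-- For a point of the cone over `P`, the dilates of `P` containing it are determined by a vertex
of the dual polyhedron. -/
theorem exists_isDualVertex_mem_smul_iff (s : Finset E)
    (hs : affineSpan ℝ (convexHull ℝ (s : Set E)) = ⊤) (h0 : (0 : E) ∈ convexHull ℝ (s : Set E))
    {a : ℝ} (ha : 0 ≤ a) {v : E} (hv : v ∈ a • convexHull ℝ (s : Set E)) :
    ∃ u, IsDualVertex (s : Set E) u ∧ (∀ u' ∈ dualPolyhedron (s : Set E), u v ≤ u' v) ∧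
      ∀ b : ℝ, 0 ≤ b → (v ∈ b • convexHull ℝ (s : Set E) ↔ -u v ≤ b) := by
  obtain ⟨u, hu, hmin⟩ := exists_isDualVertex_forall_le s
    (span_eq_top_of_affineSpan (affineSpan_convexHull (𝕜 := ℝ) (s : Set E) ▸ hs)) (v := v) (c := -a) fun u hu =>
      neg_le_of_mem_smul ha hv (by rwa [dualPolyhedron_convexHull])
  refine ⟨u, hu, hmin, fun b hb => ⟨fun h => ?_, fun h => ?_⟩⟩
  · have := neg_le_of_mem_smul hb h (u := u) (by rw [dualPolyhedron_convexHull]; exact hu.1)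
    linarith
  · refine mem_smul_of_dual (convex_convexHull ℝ _) (s.finite_toSet.isCompact_convexHull (𝕜 := ℝ)) h0 hb ?_
    intro u' hu'
    rw [dualPolyhedron_convexHull] at hu'
    linarith [hmin u' hu']

end Normed

/-! ### Integral gauge versus integral dual vertices. -/

/-- The gauge of `P` takes integer values on the points of `L` in the cone over `P`. -/
def HasIntegralGauge {E : Type*} [AddCommGroup E] [Module ℝ E] (L : Submodule ℤ E)
    (P : Set E) : Prop :=
  ∀ v ∈ L, ∀ a : ℝ, 0 ≤ a → v ∈ a • P → v ∈ ((⌊a⌋₊ : ℕ) : ℝ) • P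

theorem dualDenominator_eq_one_iff {E : Type*} [AddCommGroup E] [Module ℝ E]
    (L : Submodule ℤ E) (P : Set E) :
    dualDenominator L P = 1 ↔ IsLatticePolyhedron (dualLattice L) (dualPolyhedron P) := by
  have h1 : (1 ∈ {r : ℕ | 0 < r ∧ IsLatticePolyhedron (dualLattice L)
      ((r : ℝ) • dualPolyhedron P)}) ↔
      IsLatticePolyhedron (dualLattice L) (dualPolyhedron P) := by simp
  rw [← h1, dualDenominator]
  constructor
  · intro h
    -- The infimum of the empty set is `0`, so the value `1` is attained.
    have hne := Nat.nonempty_of_pos_sInf (h ▸ one_pos)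
    have := Nat.sInf_mem hne
    rwa [h] at this
  · intro h
    exact le_antisymm (Nat.sInf_le h) (Nat.sInf_mem ⟨1, h⟩).1

theorem isRationalPolyhedron_dualPolyhedron {E : Type*} [AddCommGroup E] [Module ℝ E]
    {L : Submodule ℤ E} {s : Finset E} (hsL : (s : Set E) ⊆ L) :
    IsRationalPolyhedron (dualLattice L) (dualPolyhedron (s : Set E)) := by
  classical
  refine ⟨s.image fun p => (Module.Dual.eval ℝ E p, -1), ?_, ?_⟩
  · intro q hq
    obtain ⟨p, hp, rfl⟩ := Finset.mem_image.1 hq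
    exact fun u hu => hu p (hsL hp)
  · ext u
    simp [dualPolyhedron]

/-- If the gauge is integral then the vertices of the dual polyhedron are dual lattice points. -/
theorem IsDualVertex.mem_dualLattice {E : Type*} [AddCommGroup E] [Module ℝ E]
    {L : Submodule ℤ E} {s : Finset E} (hsL : (s : Set E) ⊆ L)
    (h0 : (0 : E) ∈ convexHull ℝ (s : Set E))
    (h : HasIntegralGauge L (convexHull ℝ (s : Set E))) {u : Module.Dual ℝ E}
    (hu : IsDualVertex (s : Set E) u) : u ∈ dualLattice L := by
  classical
  intro x hx
  set T := s.filter (fun p => u p = -1) with hT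
  have hTu : ∀ p ∈ T, u p = -1 := fun p hp => (Finset.mem_filter.1 hp).2
  have hTs : ∀ p ∈ T, p ∈ s := fun p hp => (Finset.mem_filter.1 hp).1
  have hTspan : Submodule.span ℝ (T : Set E) = ⊤ := by
    rw [← hu.2]; congr 1; ext p; simp [hT]
  obtain ⟨c, -, hc⟩ := Submodule.mem_span_finset.1 (hTspan ▸ Submodule.mem_top : x ∈ _)
  obtain ⟨k, hk⟩ : ∃ k : ℕ, ∀ p ∈ T, 0 ≤ c p + k := by
    obtain ⟨k, hk⟩ := exists_nat_ge (∑ p ∈ T, |c p|)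
    refine ⟨k, fun p hp => ?_⟩
    have := Finset.single_le_sum (f := fun p => |c p|) (fun _ _ => abs_nonneg _) hp
    have h2 := neg_abs_le (c p)
    linarith
  -- Adding many tight points moves `x` into the cone they generate and changes `u x` by an integer.
  set y := x + k • ∑ p ∈ T, p with hy
  have hyL : y ∈ L := L.add_mem hx (L.nsmul_mem (L.sum_mem fun p hp => hsL (hTs p hp)) k)
  have hysum : y = ∑ p ∈ T, (c p + k) • p := by
    simp only [hy, ← hc, add_smul, Finset.sum_add_distrib, Finset.smul_sum, Nat.cast_smul_eq_nsmul]
  set a := ∑ p ∈ T, (c p + k) with ha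
  have ha0 : 0 ≤ a := Finset.sum_nonneg hk
  have huy : u y = -a := by
    rw [hysum, map_sum, ha, ← Finset.sum_neg_distrib]
    refine Finset.sum_congr rfl fun p hp => ?_
    rw [map_smul, hTu p hp]; simp
  have hya : y ∈ a • convexHull ℝ (s : Set E) := by
    rcases ha0.eq_or_lt with h | h
    · have hz := (Finset.sum_eq_zero_iff_of_nonneg hk).1 (ha.symm.trans h.symm)
      refine ⟨0, h0, ?_⟩
      simp only [smul_zero]
      rw [hysum, Finset.sum_eq_zero fun p hp => by rw [hz p hp, zero_smul]]
    · refine (Set.mem_smul_set_iff_inv_smul_mem₀ h.ne' _ _).2 ?_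
      rw [hysum]
      have := T.centerMass_mem_convexHull (s := (s : Set E)) (z := fun p => p) hk h
        (fun p hp => hTs p hp)
      exact this
  -- Integrality of the gauge gives `-⌊a⌋₊ ≤ u y = -a`, so `a` is an integer.
  have hfl := neg_le_of_mem_smul (Nat.cast_nonneg _) (h y hyL a ha0 hya)
    (u := u) (by rw [dualPolyhedron_convexHull]; exact hu.1)
  have hfa : a = ⌊a⌋₊ := le_antisymm (by linarith) (Nat.floor_le ha0)
  refine ⟨-⌊a⌋₊ + k * T.card, ?_⟩
  have hx' : u y = u x - k * T.card := by
    rw [hy, map_add, map_nsmul, map_sum, Finset.sum_congr rfl hTu]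
    simp
    ring
  push_cast
  linarith

/-- A lattice point on the face minimizing evaluation at `v` shows that the gauge of `v` is an
integer. Conversely, every nonempty face contains a vertex, which is integral when the gauge is. -/
theorem isLatticePolyhedron_dualPolyhedron_iff {E : Type*} [NormedAddCommGroup E]
    [NormedSpace ℝ E] [FiniteDimensional ℝ E] {L : Submodule ℤ E} {P : Set E}
    (hP : IsLatticePolytope L P) (hfull : affineSpan ℝ P = ⊤) (h0 : (0 : E) ∈ P) :
    IsLatticePolyhedron (dualLattice L) (dualPolyhedron P) ↔ HasIntegralGauge L P := by
  obtain ⟨s, hsL, rfl⟩ := hP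
  constructor
  · rintro ⟨-, hface⟩ v hv a ha hva
    obtain ⟨u, hu, hmin, hiff⟩ := exists_isDualVertex_mem_smul_iff s hfull h0 ha hva
    rw [dualPolyhedron_convexHull] at hface
    obtain ⟨u', ⟨hu', hmax⟩, hu'L⟩ := hface (-Module.Dual.eval ℝ E v)
      ⟨u, hu.1, fun y hy => by simpa using hmin y hy⟩
    have hle : u' v ≤ u v := by simpa using hmax u hu.1
    have heq : u v = u' v := le_antisymm (hmin u' hu') hle
    obtain ⟨n, hn⟩ := hu'L v hv
    rw [hiff _ (Nat.cast_nonneg _)]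
    have h1 := (hiff a ha).1 hva
    rw [heq, hn] at h1 ⊢
    have h2 : -n ≤ ⌊a⌋ := Int.le_floor.2 (by push_cast; exact h1)
    rw [natCast_floor_eq_intCast_floor ha]
    exact_mod_cast h2
  · intro h
    rw [dualPolyhedron_convexHull]
    refine ⟨isRationalPolyhedron_dualPolyhedron hsL, fun l hl => ?_⟩
    obtain ⟨u, hu, hmax⟩ := hl
    obtain ⟨w, rfl⟩ := (Module.evalEquiv ℝ E).surjective l
    simp only [Module.evalEquiv_apply, Module.Dual.eval_apply] at hmax
    obtain ⟨u', hu', hle⟩ := exists_isDualVertex_le s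
      (span_eq_top_of_affineSpan (affineSpan_convexHull (𝕜 := ℝ) (s : Set E) ▸ hfull)) (v := -w) (c := -u w)
      (fun y hy => by simpa using hmax y hy) hu
    refine ⟨u', ⟨hu'.1, fun y hy => ?_⟩, hu'.mem_dualLattice hsL h0 h⟩
    simp only [Module.evalEquiv_apply, Module.Dual.eval_apply]
    simp only [map_neg, neg_le_neg_iff] at hle
    exact (hmax y hy).trans hle

/-! ### Counting in a product of filtrations. -/

/-- The product of two filtrations, filtered by the total degree. -/
def totalFiltration {α β : Type*} (A : ℕ → Set α) (B : ℕ → Set β) (m : ℕ) : Set (α × β) :=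
  {x | ∃ i j, i + j = m ∧ x.1 ∈ A i ∧ x.2 ∈ B j}

theorem one_sub_X_mul_mk_eq (f : ℕ → ℤ) :
    (1 - PowerSeries.X) * PowerSeries.mk f =
      PowerSeries.mk fun n => f n - if n = 0 then 0 else f (n - 1) := by
  ext n
  rw [sub_mul, one_mul, map_sub]
  cases n with
  | zero => simp
  | succ n => simp [PowerSeries.coeff_succ_X_mul]

/-- The factor `1 - X` turns the counts of `A` into those of its jumps `D n`. Level `m` of the
product is the disjoint union of `D i ×ˢ B j` over `i + j = m`, with `i` the first level containing
the first coordinate. -/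
theorem mk_ncard_totalFiltration {α β : Type*} {A : ℕ → Set α} {B : ℕ → Set β}
    (hA : Monotone A) (hB : Monotone B) (hAf : ∀ n, (A n).Finite) (hBf : ∀ n, (B n).Finite) :
    PowerSeries.mk (fun m => ((totalFiltration A B m).ncard : ℤ)) =
      (1 - PowerSeries.X) * PowerSeries.mk (fun m => ((A m).ncard : ℤ)) *
        PowerSeries.mk (fun m => ((B m).ncard : ℤ)) := by
  classical
  set D : ℕ → Set α := fun n => A n \ if n = 0 then ∅ else A (n - 1) with hD
  have hDf : ∀ n, (D n).Finite := fun n => (hAf n).subset Set.sdiff_subset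
  have hDcard : ∀ n, ((D n).ncard : ℤ) =
      (A n).ncard - if n = 0 then 0 else ((A (n - 1)).ncard : ℤ) := by
    intro n
    by_cases hn : n = 0
    · simp [hD, hn]
    · have hsub : A (n - 1) ⊆ A n := hA (Nat.sub_le _ _)
      have := Set.ncard_sdiff_add_ncard_of_subset hsub (hAf n)
      simp only [hD, hn, if_false]
      omega
  have hDdisj : ∀ i j x, x ∈ D i → x ∈ D j → i = j := by
    have key : ∀ i j x, x ∈ D i → x ∈ D j → ¬ i < j := by
      intro i j x hi hj hij
      have hj2 := hj.2
      rw [if_neg (by omega)] at hj2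
      exact hj2 (hA (by omega : i ≤ j - 1) hi.1)
    intro i j x hi hj
    have := key i j x hi hj
    have := key j i x hj hi
    omega
  rw [one_sub_X_mul_mk_eq]
  ext m
  rw [PowerSeries.coeff_mul]
  simp only [PowerSeries.coeff_mk, ← hDcard]
  have hset : totalFiltration A B m =
      ↑((Finset.HasAntidiagonal.antidiagonal m).biUnion fun q => (hDf q.1).toFinset ×ˢ (hBf q.2).toFinset) := by
    ext ⟨x, y⟩
    simp only [totalFiltration, Set.mem_ofPred_eq, Finset.coe_biUnion, Finset.mem_coe,
      Finset.HasAntidiagonal.mem_antidiagonal, Set.mem_iUnion, Finset.mem_product, Set.Finite.mem_toFinset,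
      exists_prop, Prod.exists]
    constructor
    · rintro ⟨i, j, rfl, hx, hy⟩
      have hex : ∃ n, x ∈ A n := ⟨i, hx⟩
      have hle : Nat.find hex ≤ i := Nat.find_min' hex hx
      refine ⟨Nat.find hex, i + j - Nat.find hex, by omega, ⟨Nat.find_spec hex, ?_⟩,
        hB (by omega) hy⟩
      split_ifs with h
      · simp
      · exact Nat.find_min hex (by omega)
    · rintro ⟨i, j, h, hx, hy⟩
      exact ⟨i, j, h, hx.1, hy⟩
  rw [hset, Set.ncard_coe_finset, Finset.card_biUnion]
  · push_cast
    refine Finset.sum_congr rfl fun q _ => ?_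
    rw [Finset.card_product, Set.ncard_eq_toFinset_card _ (hDf _),
      Set.ncard_eq_toFinset_card _ (hBf _)]
    push_cast
    rfl
  · rintro ⟨i, j⟩ hq ⟨i', j'⟩ hq' hne
    rw [Function.onFun, Finset.disjoint_left]
    rintro ⟨x, y⟩ hx hx'
    simp only [Finset.mem_product, Set.Finite.mem_toFinset] at hx hx'
    have := hDdisj i i' x hx.1 hx'.1
    simp only [Finset.mem_coe, Finset.HasAntidiagonal.mem_antidiagonal] at hq hq'
    exact hne (Prod.ext this (by simp only; omega))

/-! ### Dilates of the free sum and separate rounding. -/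

section FreeSum

variable {E F : Type*} [AddCommGroup E] [Module ℝ E] [AddCommGroup F] [Module ℝ F]

theorem mem_smul_freeSum {P : Set E} {Q : Set F} (hP : Convex ℝ P) (hQ : Convex ℝ Q)
    (hP0 : (0 : E) ∈ P) (hQ0 : (0 : F) ∈ Q) {m : ℝ} (hm : 0 ≤ m) {x : E × F} :
    x ∈ m • freeSum P Q ↔
      ∃ a b : ℝ, 0 ≤ a ∧ 0 ≤ b ∧ a + b = m ∧ x.1 ∈ a • P ∧ x.2 ∈ b • Q := by
  have hfs : ∀ y : E × F, y ∈ freeSum P Q ↔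
      ∃ a b : ℝ, 0 ≤ a ∧ 0 ≤ b ∧ a + b = 1 ∧ y.1 ∈ a • P ∧ y.2 ∈ b • Q := by
    intro y
    have hne : (P ×ˢ ({0} : Set F)).Nonempty := ⟨(0, 0), hP0, rfl⟩
    have hne' : (({0} : Set E) ×ˢ Q).Nonempty := ⟨(0, 0), rfl, hQ0⟩
    rw [freeSum, convexHull_union hne hne',
      (hP.prod (convex_singleton 0)).convexHull_eq, ((convex_singleton 0).prod hQ).convexHull_eq]
    simp only [mem_convexJoin, segment, Set.mem_ofPred_eq]
    constructor
    · rintro ⟨⟨p, p'⟩, ⟨hp, hp'⟩, ⟨q', q⟩, ⟨hq', hq⟩, a, b, ha, hb, hab, rfl⟩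
      obtain rfl : p' = 0 := hp'
      obtain rfl : q' = 0 := hq'
      exact ⟨a, b, ha, hb, hab, ⟨p, hp, by simp⟩, ⟨q, hq, by simp⟩⟩
    · rintro ⟨a, b, ha, hb, hab, ⟨p, hp, h1⟩, ⟨q, hq, h2⟩⟩
      refine ⟨(p, 0), ⟨hp, rfl⟩, (0, q), ⟨rfl, hq⟩, a, b, ha, hb, hab, ?_⟩
      ext
      · simpa using h1
      · simpa using h2
  constructor
  · rintro ⟨y, hy, rfl⟩
    obtain ⟨a, b, ha, hb, hab, h1, h2⟩ := (hfs y).1 hy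
    refine ⟨m * a, m * b, by positivity, by positivity, by rw [← mul_add, hab, mul_one], ?_, ?_⟩
    · rw [mul_smul]; exact Set.smul_mem_smul_set h1
    · rw [mul_smul]; exact Set.smul_mem_smul_set h2
  · rintro ⟨a, b, ha, hb, rfl, ⟨p, hp, h1⟩, ⟨q, hq, h2⟩⟩
    -- The zero dilate is treated apart because the other case divides by `a + b`.
    rcases hm.eq_or_lt with h | h
    · have ha' : a = 0 := by linarith
      have hb' : b = 0 := by linarith
      subst ha' hb'
      refine ⟨0, (hfs 0).2 ⟨1, 0, by simp, le_rfl, by simp, ⟨0, hP0, by simp⟩, ⟨0, hQ0, by simp⟩⟩, ?_⟩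
      ext
      · simpa using h1
      · simpa using h2
    · rw [Set.mem_smul_set_iff_inv_smul_mem₀ h.ne', hfs]
      refine ⟨(a + b)⁻¹ * a, (a + b)⁻¹ * b, by positivity, by positivity, ?_, ?_, ?_⟩
      · rw [← mul_add, inv_mul_cancel₀ h.ne']
      · exact ⟨p, hp, by simp [← h1, mul_smul]⟩
      · exact ⟨q, hq, by simp [← h2, mul_smul]⟩

theorem vectorSpan_freeSum {P : Set E} {Q : Set F} (hP : affineSpan ℝ P = ⊤)
    (hQ : affineSpan ℝ Q = ⊤) (hP0 : (0 : E) ∈ P) :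
    vectorSpan ℝ (freeSum P Q) = ⊤ := by
  have hsub : ∀ x ∈ freeSum P Q, x ∈ vectorSpan ℝ (freeSum P Q) := fun x hx => by
    have h0 : (0 : E × F) ∈ freeSum P Q := subset_convexHull ℝ _ (Or.inl ⟨hP0, rfl⟩)
    simpa using vsub_mem_vectorSpan ℝ hx h0
  have h1 : (⊤ : Submodule ℝ E) ≤ (vectorSpan ℝ (freeSum P Q)).comap (LinearMap.inl ℝ E F) := by
    rw [← span_eq_top_of_affineSpan hP, Submodule.span_le]
    exact fun p hp => hsub _ (subset_convexHull ℝ _ (Or.inl ⟨hp, rfl⟩))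
  have h2 : (⊤ : Submodule ℝ F) ≤ (vectorSpan ℝ (freeSum P Q)).comap (LinearMap.inr ℝ E F) := by
    rw [← span_eq_top_of_affineSpan hQ, Submodule.span_le]
    exact fun q hq => hsub _ (subset_convexHull ℝ _ (Or.inr ⟨rfl, hq⟩))
  refine eq_top_iff.2 fun x _ => ?_
  have hx : x = LinearMap.inl ℝ E F x.1 + LinearMap.inr ℝ E F x.2 := by ext <;> simp
  rw [hx]
  exact Submodule.add_mem _ (h1 (Submodule.mem_top (R := ℝ)))
    (h2 (Submodule.mem_top (R := ℝ)))

theorem dim_eq_finrank {P : Set E} (hP : affineSpan ℝ P = ⊤) : dim P = Module.finrank ℝ E := by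
  rw [dim, ← direction_affineSpan, hP, AffineSubspace.direction_top, finrank_top]

/-- The gauges of `P` and `Q` can be rounded up separately. -/
def RoundsSeparately (L : Submodule ℤ E) (L' : Submodule ℤ F) (P : Set E) (Q : Set F) : Prop :=
  ∀ m : ℕ, ∀ v ∈ L, ∀ w ∈ L', ∀ a b : ℝ, 0 ≤ a → 0 ≤ b → a + b = m → v ∈ a • P → w ∈ b • Q →
    ∃ i j : ℕ, i + j = m ∧ v ∈ (i : ℝ) • P ∧ w ∈ (j : ℝ) • Q

/-- Round `a` down to `⌊a⌋₊` and give the slack to `b`; since `a + b = m` is an integer, `b ≤ m -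
⌊a⌋₊`. -/
theorem HasIntegralGauge.roundsSeparately {L : Submodule ℤ E} {P : Set E}
    (h : HasIntegralGauge L P) (L' : Submodule ℤ F) {Q : Set F} (hQ : Convex ℝ Q)
    (hQ0 : (0 : F) ∈ Q) : RoundsSeparately L L' P Q := by
  intro m v hv w hw a b ha hb hab hva hwb
  have h1 := Nat.floor_le ha
  have h2 : ⌊a⌋₊ ≤ m := Nat.floor_le_of_le (by linarith)
  refine ⟨⌊a⌋₊, m - ⌊a⌋₊, by omega, h v hv a ha hva, smul_mono hQ hQ0 hb ?_ hwb⟩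
  rw [Nat.cast_sub h2]
  linarith

theorem RoundsSeparately.symm {L : Submodule ℤ E} {L' : Submodule ℤ F} {P : Set E} {Q : Set F}
    (h : RoundsSeparately L L' P Q) : RoundsSeparately L' L Q P := by
  intro m w hw v hv b a hb ha hab hwb hva
  obtain ⟨i, j, hij, hi, hj⟩ := h m v hv w hw a b ha hb (by linarith) hva hwb
  exact ⟨j, i, by omega, hj, hi⟩

end FreeSum

/-- If the fractional part is `1 - δ` with `δ < 1/2`, that of `k * x` is `1 - k * δ` while `k * δ <
1`. The steps `δ` are too short to jump over `[1/2, 1)`. -/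
theorem exists_nat_mul_fract_le_half {x : ℝ} (hx : 0 < Int.fract x) :
    ∃ k : ℕ, 0 < k ∧ 0 < Int.fract (k * x) ∧ Int.fract (k * x) ≤ 1 / 2 := by
  by_cases h : Int.fract x ≤ 1 / 2
  · exact ⟨1, one_pos, by simpa using hx, by simpa using h⟩
  set δ := 1 - Int.fract x with hδ
  have hδ0 : 0 < δ := by linarith [Int.fract_lt_one x]
  set k := ⌈1 / (2 * δ)⌉₊ with hk
  have h1 : 1 / (2 * δ) ≤ k := Nat.le_ceil _
  have h2 : (k : ℝ) < 1 / (2 * δ) + 1 := Nat.ceil_lt_add_one (by positivity)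
  have h3 : 1 / 2 ≤ k * δ := by
    have := mul_le_mul_of_nonneg_right h1 hδ0.le
    have e : 1 / (2 * δ) * δ = 1 / 2 := by field_simp
    linarith
  have h4 : k * δ < 1 := by
    have := mul_lt_mul_of_pos_right h2 hδ0
    have e : (1 / (2 * δ) + 1) * δ = 1 / 2 + δ := by field_simp
    linarith
  have hfr : Int.fract (k * x) = 1 - k * δ := by
    rw [Int.fract_eq_iff]
    refine ⟨by linarith, by linarith, k * ⌊x⌋ + k - 1, ?_⟩
    push_cast
    rw [hδ]
    have := Int.floor_add_fract x
    linear_combination (-(k : ℝ)) * this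
  exact ⟨k, Nat.ceil_pos.2 (by positivity), by rw [hfr]; linarith, by rw [hfr]; linarith⟩

/-! ### Rounding obstruction and the comparison of series. -/

section Main

variable {E : Type*} [NormedAddCommGroup E] [NormedSpace ℝ E]

/-- If the gauge is not integral, some lattice point has gauge with fractional part in
`(0, 1 / 2]`. -/
theorem exists_fract_le_half_of_not_hasIntegralGauge {L : Submodule ℤ E} {P : Set E}
    (hP : IsLatticePolytope L P) (hfull : affineSpan ℝ P = ⊤) (h0 : (0 : E) ∈ P)
    (h : ¬ HasIntegralGauge L P) :
    ∃ v ∈ L, ∃ (n : ℕ) (c : ℝ), 0 < c ∧ c ≤ 1 / 2 ∧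
      ∀ b : ℝ, 0 ≤ b → (v ∈ b • P ↔ n + c ≤ b) := by
  obtain ⟨s, hsL, rfl⟩ := hP
  simp only [HasIntegralGauge, not_forall] at h
  obtain ⟨v, hv, a, ha, hva, hnot⟩ := h
  obtain ⟨u, hu, hmin, hiff⟩ := exists_isDualVertex_mem_smul_iff s hfull h0 ha hva
  have hu0 : 0 ≤ -u v := by
    have := hmin 0 (zero_mem_dualPolyhedron _)
    simp only [LinearMap.zero_apply] at this
    linarith
  have h1 := (hiff a ha).1 hva
  rw [hiff _ (Nat.cast_nonneg _), not_le] at hnot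
  -- The gauge `-u v` lies strictly above `⌊a⌋₊` and at most at `a`, so it is not an integer.
  have hfr : 0 < Int.fract (-u v) := by
    have : (⌊-u v⌋ : ℝ) ≤ ⌊a⌋₊ := by
      rw [natCast_floor_eq_intCast_floor ha]
      exact_mod_cast Int.floor_mono h1
    rw [Int.fract]
    linarith
  obtain ⟨k, hk, hk1, hk2⟩ := exists_nat_mul_fract_le_half hfr
  have hk0 : (0 : ℝ) < k := by exact_mod_cast hk
  refine ⟨k • v, L.nsmul_mem hv k, ⌊k * -u v⌋₊, Int.fract (k * -u v), hk1, hk2, fun b hb => ?_⟩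
  rw [natCast_floor_eq_intCast_floor (by positivity), Int.floor_add_fract]
  have hb' : 0 ≤ (k : ℝ)⁻¹ * b := by positivity
  rw [← Nat.cast_smul_eq_nsmul ℝ, show b = k * ((k : ℝ)⁻¹ * b) by field_simp, mul_smul,
    Set.smul_mem_smul_set_iff₀ hk0.ne', hiff _ hb']
  exact (mul_le_mul_iff_right₀ hk0).symm

variable {F : Type*} [NormedAddCommGroup F] [NormedSpace ℝ F]

theorem roundsSeparately_iff {L : Submodule ℤ E} {L' : Submodule ℤ F} {P : Set E} {Q : Set F}
    (hP : IsLatticePolytope L P) (hQ : IsLatticePolytope L' Q)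
    (hPfull : affineSpan ℝ P = ⊤) (hQfull : affineSpan ℝ Q = ⊤)
    (hP0 : (0 : E) ∈ P) (hQ0 : (0 : F) ∈ Q) :
    RoundsSeparately L L' P Q ↔ HasIntegralGauge L P ∨ HasIntegralGauge L' Q := by
  constructor
  · intro h
    by_contra! hn
    obtain ⟨v, hv, n, c, hc, hc2, hiff⟩ :=
      exists_fract_le_half_of_not_hasIntegralGauge hP hPfull hP0 hn.1
    obtain ⟨w, hw, n', c', hc', hc2', hiff'⟩ :=
      exists_fract_le_half_of_not_hasIntegralGauge hQ hQfull hQ0 hn.2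
    have hn0 := Nat.cast_nonneg (α := ℝ) n
    have hn0' := Nat.cast_nonneg (α := ℝ) n'
    -- As `c, c' ≤ 1/2`, the factor `n' + (1 - c)` is at least `n' + c'`. Separate rounding would
    -- need `i ≥ n + 1` and `j ≥ n' + 1`, exceeding the total.
    obtain ⟨i, j, hij, hi, hj⟩ := h (n + n' + 1) v hv w hw (n + c) (n' + (1 - c))
      (by linarith) (by linarith) (by push_cast; ring)
      ((hiff _ (by linarith)).2 le_rfl) ((hiff' _ (by linarith)).2 (by linarith))
    rw [hiff _ (Nat.cast_nonneg _)] at hi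
    rw [hiff' _ (Nat.cast_nonneg _)] at hj
    have hi' : n < i := by
      have : (n : ℝ) < i := by linarith
      exact_mod_cast this
    have hj' : n' < j := by
      have : (n' : ℝ) < j := by linarith
      exact_mod_cast this
    omega
  · rintro (h | h)
    · exact h.roundsSeparately L' hQ.convex hQ0
    · exact (h.roundsSeparately L hP.convex hP0).symm

/-- The total filtration always lies in the lattice points of the dilated free sum. These sets are
finite, so equal coefficients mean equal sets, which is the rounding condition. -/
theorem hStar_freeSum_eq_iff [FiniteDimensional ℝ E] [FiniteDimensional ℝ F]
    {L : Submodule ℤ E} [DiscreteTopology L] {L' : Submodule ℤ F}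
    [DiscreteTopology L'] {P : Set E} {Q : Set F}
    (hP : IsLatticePolytope L P) (hQ : IsLatticePolytope L' Q)
    (hPfull : affineSpan ℝ P = ⊤) (hQfull : affineSpan ℝ Q = ⊤)
    (hP0 : (0 : E) ∈ P) (hQ0 : (0 : F) ∈ Q) :
    hStar (L.prod L') (freeSum P Q) = hStar L P * hStar L' Q ↔ RoundsSeparately L L' P Q := by
  set A : ℕ → Set E := fun m => ((m : ℝ) • P) ∩ L with hA
  set B : ℕ → Set F := fun m => ((m : ℝ) • Q) ∩ L' with hB
  have hAf : ∀ n, (A n).Finite := fun n => finite_smul_inter L hP.isCompact n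
  have hBf : ∀ n, (B n).Finite := fun n => finite_smul_inter L' hQ.isCompact n
  have hAm : Monotone A := fun i j hij => Set.inter_subset_inter_left _
    (smul_mono hP.convex hP0 (Nat.cast_nonneg i) (Nat.cast_le.2 hij))
  have hBm : Monotone B := fun i j hij => Set.inter_subset_inter_left _
    (smul_mono hQ.convex hQ0 (Nat.cast_nonneg i) (Nat.cast_le.2 hij))
  have hsub : ∀ m, totalFiltration A B m ⊆ ((m : ℝ) • freeSum P Q) ∩ (L.prod L' : Set (E × F)) := by
    rintro m ⟨v, w⟩ ⟨i, j, rfl, hv, hw⟩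
    refine ⟨(mem_smul_freeSum hP.convex hQ.convex hP0 hQ0 (Nat.cast_nonneg _)).2
      ⟨i, j, Nat.cast_nonneg i, Nat.cast_nonneg j, by push_cast; rfl, hv.1, hw.1⟩, hv.2, hw.2⟩
  have hfin : ∀ m : ℕ, (((m : ℝ) • freeSum P Q) ∩ (L.prod L' : Set (E × F))).Finite := by
    intro m
    refine ((hAf m).prod (hBf m)).subset ?_
    rintro ⟨v, w⟩ ⟨h, hv, hw⟩
    obtain ⟨a, b, ha, hb, hab, h1, h2⟩ :=
      (mem_smul_freeSum hP.convex hQ.convex hP0 hQ0 (Nat.cast_nonneg _)).1 h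
    exact ⟨⟨smul_mono hP.convex hP0 ha (by linarith) h1, hv⟩,
      ⟨smul_mono hQ.convex hQ0 hb (by linarith) h2, hw⟩⟩
  have hdim : dim (freeSum P Q) = dim P + dim Q := by
    rw [dim_eq_finrank hPfull, dim_eq_finrank hQfull, dim,
      vectorSpan_freeSum hPfull hQfull hP0, finrank_top, Module.finrank_prod]
  have hX : (1 - PowerSeries.X : PowerSeries ℤ) ≠ 0 := by
    intro h
    have := congrArg (PowerSeries.coeff 0) h
    simp at this
  -- Of the `dim P + dim Q + 2` factors `1 - X`, one is absorbed by the product count.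
  have hprod : hStar L P * hStar L' Q = (1 - PowerSeries.X) ^ (dim P + dim Q + 1) *
      PowerSeries.mk (fun m => ((totalFiltration A B m).ncard : ℤ)) := by
    rw [mk_ncard_totalFiltration hAm hBm hAf hBf]
    simp only [hStar, ehrhart, hA, hB]
    ring
  rw [hprod, hStar, hdim, mul_right_inj' (pow_ne_zero _ hX), PowerSeries.ext_iff]
  simp only [PowerSeries.coeff_mk, ehrhart, Nat.cast_inj]
  refine forall_congr' fun m => ?_
  constructor
  · intro h v hv w hw a b ha hb hab hva hwb
    have heq := Set.eq_of_subset_of_ncard_le (hsub m) h.le (hfin m)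
    have hmem : (v, w) ∈ totalFiltration A B m := by
      rw [heq]
      exact ⟨(mem_smul_freeSum hP.convex hQ.convex hP0 hQ0 (Nat.cast_nonneg _)).2
        ⟨a, b, ha, hb, hab, hva, hwb⟩, hv, hw⟩
    obtain ⟨i, j, hij, hi, hj⟩ := hmem
    exact ⟨i, j, hij, hi.1, hj.1⟩
  · intro h
    congr 1
    refine Set.Subset.antisymm ?_ (hsub m)
    rintro ⟨v, w⟩ ⟨hvw, hv, hw⟩
    obtain ⟨a, b, ha, hb, hab, h1, h2⟩ :=
      (mem_smul_freeSum hP.convex hQ.convex hP0 hQ0 (Nat.cast_nonneg _)).1 hvw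
    obtain ⟨i, j, hij, hi, hj⟩ := h v hv w hw a b ha hb hab h1 h2
    exact ⟨i, j, hij, ⟨hi, hv⟩, ⟨hj, hw⟩⟩

end Main

end LatticePolytope

theorem mainTheorem3
    {E : Type*} [NormedAddCommGroup E] [NormedSpace ℝ E] [FiniteDimensional ℝ E]
    {F : Type*} [NormedAddCommGroup F] [NormedSpace ℝ F] [FiniteDimensional ℝ F]
    (L : Submodule ℤ E) [DiscreteTopology L] [IsZLattice ℝ L]
    (L' : Submodule ℤ F) [DiscreteTopology L'] [IsZLattice ℝ L']
    (P : Set E) (Q : Set F)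
    (hP : LatticePolytope.IsLatticePolytope L P) (hQ : LatticePolytope.IsLatticePolytope L' Q)
    (hPfull : affineSpan ℝ P = ⊤) (hQfull : affineSpan ℝ Q = ⊤)
    (hP0 : (0 : E) ∈ P) (hQ0 : (0 : F) ∈ Q) :
    LatticePolytope.hStar (L.prod L') (LatticePolytope.freeSum P Q) =
        LatticePolytope.hStar L P * LatticePolytope.hStar L' Q ↔
      (LatticePolytope.dualDenominator L P = 1 ∨ LatticePolytope.dualDenominator L' Q = 1) := by
  rw [LatticePolytope.hStar_freeSum_eq_iff hP hQ hPfull hQfull hP0 hQ0,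
    LatticePolytope.roundsSeparately_iff hP hQ hPfull hQfull hP0 hQ0,
    LatticePolytope.dualDenominator_eq_one_iff, LatticePolytope.dualDenominator_eq_one_iff,
    LatticePolytope.isLatticePolyhedron_dualPolyhedron_iff hP hPfull hP0,
    LatticePolytope.isLatticePolyhedron_dualPolyhedron_iff hQ hQfull hQ0]
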